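/- Let $b_1,b_2,\dots$ be integers with $b_n\ge 1$. Divide the positions of an infinite integer sequence into consecutive bins, the $n$-th bin having length $b_n$. A finite set of terms of the sequence is called legal if it contains at most one term from each bin. The $(\{b_n\},\{0,1\},0)$-Sequence is constructed greedily: its first term is $1$, and once the first $k$ terms have been constructed, the next term is the least positive integer that is not the sum of a legal set of these $k$ terms. A legal decomposition of an integer $x$ is a legal set of terms whose sum is $x$. Suppose that $\sum_{n=1}^\infty 1/b_n$ diverges. Then every positive integer $x$ has exactly one legal decomposition. Let $Y_n(x)=1$ if a term of the $n$-th bin appears in the decomposition of $x$, and $Y_n(x)=0$ otherwise, and let $K(x)$ be the number of summands of $x$'s decomposition. For $N\ge 1$ let $S_N$ be the set of integers $x$ whose largest summand lies in bin $N$. This set is finite and non-empty; let $P_N$ be the uniform probability measure on it. Then: 1. $K(x)=Y_1(x)+\cdots+Y_N(x)$ for every $x\in S_N$. 2. Under $P_N$ the variables $Y_1,\dots,Y_N$ are independent, $P_N(Y_n=1)=\frac{b_n}{b_n+1}$ and $P_N(Y_n=0)=\frac1{b_n+1}$ for $n<N$, and $Y_N=1$ on $S_N$. 3. (Lyapunov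 condition) For every $\delta>0$, $$\lim_{N\to\infty}\frac{\sum_{n=1}^{N}\mathbb E_{P_N}\big[|Y_n-\mathbb E_{P_N}Y_n|^{2+\delta}\big]}{\Big(\sum_{n=1}^{N}\mathrm{Var}_{P_N}(Y_n)\Big)^{(2+\delta)/2}}=0 .$$ 4. As $N\to\infty$, the number of summands of a uniformly random element of $S_N$, standardized as $\dfrac{K-\mathbb E_{P_N}[K]}{\sqrt{\mathrm{Var}_{P_N}(K)}}$, converges in distribution to the standard normal law. -/

import Mathlib

open MeasureTheory ProbabilityTheory Filter Topology

namespace BinDecomp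

noncomputable section

/-- Bins and positions are numbered from `0`: bin `n` has length `b n`, the terms of the sequence
sit at the positions `0, 1, 2, …`, and this is the first position of bin `n`. -/
def binStart (b : ℕ → ℕ) (n : ℕ) : ℕ := ∑ i ∈ Finset.range n, b i

/-- The positions that belong to bin `n`. -/
def bin (b : ℕ → ℕ) (n : ℕ) : Finset ℕ := Finset.Ico (binStart b n) (binStart b (n + 1))

/-- A finite set of positions is legal if the number of positions chosen from bin `n` lies in
`A n` for every `n`, and any two different bins that are used have at least `a` bins between
them. -/
def IsLegal (b : ℕ → ℕ) (A : ℕ → Set ℕ) (a : ℕ) (D : Finset ℕ) : Prop :=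
  (∀ n, (D ∩ bin b n).card ∈ A n) ∧
  ∀ m n, m < n → (D ∩ bin b m).Nonempty → (D ∩ bin b n).Nonempty → m + a < n

/-- The `({b_n}, {A_n}, a)`-sequence: the term at position `k` is the least positive integer that
is not the sum of the terms over a legal set of positions smaller than `k`. In particular the
first term is `1`. -/
def binSeq (b : ℕ → ℕ) (A : ℕ → Set ℕ) (a : ℕ) (k : ℕ) : ℕ :=
  sInf {m : ℕ | 0 < m ∧ ∀ D : Finset (Fin k),
    IsLegal b A a (D.map Fin.valEmbedding) → ∑ i ∈ D, binSeq b A a i.val ≠ m}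
termination_by k
decreasing_by exact i.isLt

/-- The infimum in the definition of `binSeq` is attained. -/
theorem binSeq_isLeast (b : ℕ → ℕ) (A : ℕ → Set ℕ) (a : ℕ) (k : ℕ) :
    IsLeast {m : ℕ | 0 < m ∧ ∀ D : Finset (Fin k),
      IsLegal b A a (D.map Fin.valEmbedding) → ∑ i ∈ D, binSeq b A a i.val ≠ m}
      (binSeq b A a k) := by
  have hne : {m : ℕ | 0 < m ∧ ∀ D : Finset (Fin k),
      IsLegal b A a (D.map Fin.valEmbedding) → ∑ i ∈ D, binSeq b A a i.val ≠ m}.Nonempty := by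
    refine ⟨∑ i : Fin k, binSeq b A a i.val + 1, Nat.succ_pos _, fun D _ h => ?_⟩
    have := Finset.sum_le_univ_sum_of_nonneg (s := D)
      (f := fun i : Fin k => binSeq b A a i.val) (fun _ => Nat.zero_le _)
    omega
  rw [binSeq]
  exact ⟨Nat.sInf_mem hne, fun m hm => Nat.sInf_le hm⟩

/-- `D` is (the set of positions of the summands of) a legal decomposition of `x`. -/
def IsDecomposition (b : ℕ → ℕ) (A : ℕ → Set ℕ) (a : ℕ) (D : Finset ℕ) (x : ℕ) : Prop :=
  IsLegal b A a D ∧ ∑ i ∈ D, binSeq b A a i = x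

open Classical in
/-- The legal decomposition of `x` (the empty set if there is none). -/
def decomposition (b : ℕ → ℕ) (A : ℕ → Set ℕ) (a : ℕ) (x : ℕ) : Finset ℕ :=
  if h : ∃ D, IsDecomposition b A a D x then h.choose else ∅

/-- The number of summands in the decomposition of `x`. -/
def numSummands (b : ℕ → ℕ) (A : ℕ → Set ℕ) (a : ℕ) (x : ℕ) : ℕ :=
  (decomposition b A a x).card

open Classical in
/-- `Y_n(x)`: equal to `1` if an element of bin `n` appears in the decomposition of `x`, and to
`0` otherwise. -/
def usesBin (b : ℕ → ℕ) (A : ℕ → Set ℕ) (a : ℕ) (n x : ℕ) : ℝ :=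
  if (decomposition b A a x ∩ bin b n).Nonempty then 1 else 0

/-- The integers whose largest summand lies in bin `N`. -/
def largestInBin (b : ℕ → ℕ) (A : ℕ → Set ℕ) (a : ℕ) (N : ℕ) : Set ℕ :=
  {x | ∃ k ∈ decomposition b A a x, k ∈ bin b N ∧
    ∀ j ∈ decomposition b A a x, binSeq b A a j ≤ binSeq b A a k}

/-- The uniform distribution on the integers whose largest summand lies in bin `N`. -/
def unifLaw (b : ℕ → ℕ) (A : ℕ → Set ℕ) (a : ℕ) (N : ℕ) : Measure ℕ :=
  uniformOn (largestInBin b A a N)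

/-- The constant choice `A_n = {0, 1}`: at most one summand from each bin. -/
def zeroOne : ℕ → Set ℕ := fun _ => {0, 1}

end

end BinDecomp

/-! Put `place b n` = ∏_{i<n} (b i + 1). The terms of bin n are the multiples d · `place b n` with 1
≤ d ≤ b n (`binSeq_eq_binTerm`), so choosing at most one term per bin amounts to choosing a digit 0
≤ d ≤ b n in every place of the mixed radix system with radices b n + 1. Legal decompositions are
therefore digit expansions, which gives existence and uniqueness, and Y_n records whether digit n is
non-zero.

The integers with largest summand in bin N fill the interval [`place b N`, `place b (N + 1)`)
(`largestInBin_eq`). Under the uniform law there, the digits are independent and uniform on their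
ranges, with 0 excluded only for the leading digit (`map_digits_unifLaw`). Hence the Y_n are
independent, and for n < N the variance is b_n/(b_n+1)² ≥ 1/(4 b_n), so the total variance diverges
with ∑ 1/b_n. As |Y_n − E Y_n| ≤ 1, the Lyapunov ratio is at most a negative power of the standard
deviation, and the limit law follows from a central limit theorem for bounded triangular arrays,
proved with characteristic functions (`tendstoInDistribution_sum_of_bounded`). -/

/-! ### Central limit theorem for bounded triangular arrays. -/

/-- The difference of two products of complex numbers in the unit disc is at most the sum of the
differences of the factors. -/
lemma norm_prod_sub_prod_le_sum {ι : Type*} (s : Finset ι) (f g : ι → ℂ)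
    (hf : ∀ i ∈ s, ‖f i‖ ≤ 1) (hg : ∀ i ∈ s, ‖g i‖ ≤ 1) :
    ‖∏ i ∈ s, f i - ∏ i ∈ s, g i‖ ≤ ∑ i ∈ s, ‖f i - g i‖ := by
  classical
  induction s using Finset.induction_on with
  | empty => simp
  | insert a s ha ih =>
    rw [Finset.prod_insert ha, Finset.prod_insert ha, Finset.sum_insert ha]
    have hs := ih (fun i hi => hf i (Finset.mem_insert_of_mem hi))
      (fun i hi => hg i (Finset.mem_insert_of_mem hi))
    have hP : ‖∏ i ∈ s, f i‖ ≤ 1 := by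
      rw [norm_prod]
      exact Finset.prod_le_one (fun _ _ => norm_nonneg _)
        (fun i hi => hf i (Finset.mem_insert_of_mem hi))
    have hga := hg a (Finset.mem_insert_self _ _)
    calc ‖f a * ∏ i ∈ s, f i - g a * ∏ i ∈ s, g i‖
        = ‖(f a - g a) * ∏ i ∈ s, f i + g a * (∏ i ∈ s, f i - ∏ i ∈ s, g i)‖ := by
          congr 1; ring
      _ ≤ ‖f a - g a‖ * ‖∏ i ∈ s, f i‖ + ‖g a‖ * ‖∏ i ∈ s, f i - ∏ i ∈ s, g i‖ := by
          rw [← norm_mul, ← norm_mul]; exact norm_add_le _ _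
      _ ≤ ‖f a - g a‖ * 1 + 1 * ‖∏ i ∈ s, f i - ∏ i ∈ s, g i‖ := by gcongr
      _ ≤ _ := by linarith

lemma norm_exp_mul_I_sub_le {u : ℝ} (hu : |u| ≤ 1) :
    ‖Complex.exp (u * Complex.I) - (1 + u * Complex.I - u ^ 2 / 2)‖ ≤ |u| ^ 3 := by
  have hn : ‖(u : ℂ) * Complex.I‖ = |u| := by simp
  have h := Complex.exp_bound (x := u * Complex.I) (by rw [hn]; exact hu) (n := 3) (by norm_num)
  have hs : ∑ m ∈ Finset.range 3, ((u : ℂ) * Complex.I) ^ m / (m.factorial : ℂ)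
      = 1 + u * Complex.I - u ^ 2 / 2 := by
    simp [Finset.sum_range_succ, mul_pow, Nat.factorial]
    ring
  rw [hs, hn] at h
  refine h.trans ?_
  have : (0 : ℝ) ≤ |u| ^ 3 := by positivity
  -- The constant from `Complex.exp_bound` is 4 / (3! · 3) = 2/9, which is below 1.
  norm_num [Nat.factorial]
  linarith

/-- The characteristic function of a small centered random variable is close to that of the
centered Gaussian with the same variance. -/
lemma norm_charFun_map_sub_exp_le {Ω : Type*} {mΩ : MeasurableSpace Ω} {P : Measure Ω}
    [IsProbabilityMeasure P] {X : Ω → ℝ} (hX : AEMeasurable X P) (h0 : P[X] = 0) {ε t : ℝ}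
    (hε : ∀ᵐ ω ∂P, |X ω| ≤ ε) (ht : |t| * ε ≤ 1) :
    ‖charFun (P.map X) t - Complex.exp (-(t ^ 2 * Var[X; P] / 2 : ℝ))‖
      ≤ (|t| ^ 3 * ε + t ^ 4 * ε ^ 2) * Var[X; P] := by
  have hε0 : 0 ≤ ε := by
    obtain ⟨ω, hω⟩ := hε.exists
    exact (abs_nonneg _).trans hω
  have hvar : Var[X; P] = ∫ ω, X ω ^ 2 ∂P := by
    rw [variance_eq_integral hX, h0]; simp
  have hi1 : Integrable X P := Integrable.of_bound hX.aestronglyMeasurable ε hε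
  have hi2 : Integrable (fun ω => X ω ^ 2) P := by
    refine Integrable.of_bound (hX.pow_const 2).aestronglyMeasurable (ε ^ 2) ?_
    filter_upwards [hε] with ω hω
    rw [norm_pow]; exact pow_le_pow_left₀ (norm_nonneg _) hω 2
  have hv0 : 0 ≤ Var[X; P] := variance_nonneg _ _
  -- This later trades Var² for ε² · Var. The error must be linear in the variance, so that it can
  -- be summed over a row of total variance 1.
  have hvε : Var[X; P] ≤ ε ^ 2 := by
    rw [hvar]
    calc ∫ ω, X ω ^ 2 ∂P ≤ ∫ _, ε ^ 2 ∂P := by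
          refine integral_mono_ae hi2 (integrable_const _) ?_
          filter_upwards [hε] with ω hω
          exact sq_le_sq' (abs_le.1 hω).1 (abs_le.1 hω).2
      _ = ε ^ 2 := by simp
  have hie : Integrable (fun ω => Complex.exp (((t * X ω : ℝ) : ℂ) * Complex.I)) P := by
    refine Integrable.of_bound (C := 1) ?_ (.of_forall fun ω => ?_)
    · exact (by fun_prop : AEMeasurable _ P).aestronglyMeasurable
    · rw [Complex.norm_exp_ofReal_mul_I]
  have hi1' : Integrable (fun ω => ((t * X ω : ℝ) : ℂ) * Complex.I) P :=
    ((hi1.const_mul t).ofReal).mul_const _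
  have hi2' : Integrable (fun ω => ((t * X ω : ℝ) : ℂ) ^ 2 / 2) P := by
    refine (((hi2.const_mul (t ^ 2)).ofReal (𝕜 := ℂ)).div_const 2).congr (.of_forall fun ω => ?_)
    simp [mul_pow]
  have hi12 : Integrable (fun ω => 1 + ((t * X ω : ℝ) : ℂ) * Complex.I) P :=
    (integrable_const _).add hi1'
  have hip : Integrable (fun ω => 1 + ((t * X ω : ℝ) : ℂ) * Complex.I
      - ((t * X ω : ℝ) : ℂ) ^ 2 / 2) P := hi12.sub hi2'
  have hIp : ∫ ω, (1 + ((t * X ω : ℝ) : ℂ) * Complex.I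
      - ((t * X ω : ℝ) : ℂ) ^ 2 / 2) ∂P = 1 - ((t ^ 2 * Var[X; P] / 2 : ℝ) : ℂ) := by
    have e1 : ∫ ω, ((t * X ω : ℝ) : ℂ) * Complex.I ∂P = 0 := by
      rw [integral_mul_const, integral_complex_ofReal, integral_const_mul, h0]; simp
    have e2 : ∫ ω, ((t * X ω : ℝ) : ℂ) ^ 2 / 2 ∂P = ((t ^ 2 * Var[X; P] / 2 : ℝ) : ℂ) := by
      rw [hvar, ← integral_const_mul, ← integral_div, ← integral_complex_ofReal]
      congr 1 with ω
      simp [mul_pow]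
    rw [integral_sub hi12 hi2', integral_add (integrable_const _) hi1', e1, e2]
    simp
  have hchar : charFun (P.map X) t = ∫ ω, Complex.exp (((t * X ω : ℝ) : ℂ) * Complex.I) ∂P := by
    rw [charFun_apply_real, integral_map hX]
    · simp
    · exact (by fun_prop : AEMeasurable _ _).aestronglyMeasurable
  -- The cubic Taylor remainder satisfies |tX|³ ≤ |t|³ ε X², and X² integrates to the variance.
  have hA : ‖charFun (P.map X) t - (1 - ((t ^ 2 * Var[X; P] / 2 : ℝ) : ℂ))‖
      ≤ |t| ^ 3 * ε * Var[X; P] := by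
    rw [hchar, ← hIp, ← integral_sub hie hip, hvar, ← integral_const_mul]
    refine norm_integral_le_of_norm_le (hi2.const_mul _) ?_
    filter_upwards [hε] with ω hω
    have hu : |t * X ω| ≤ 1 := by
      rw [abs_mul]; exact (mul_le_mul_of_nonneg_left hω (abs_nonneg t)).trans ht
    refine (norm_exp_mul_I_sub_le hu).trans ?_
    rw [abs_mul, mul_pow, mul_assoc, ← sq_abs (X ω), pow_succ |X ω| 2, mul_comm (|X ω| ^ 2)]
    gcongr
  have hw0 : 0 ≤ t ^ 2 * Var[X; P] / 2 := by positivity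
  have htε : t ^ 2 * ε ^ 2 ≤ 1 := by
    rw [← sq_abs t, ← mul_pow]; exact pow_le_one₀ (by positivity) ht
  have hw1 : t ^ 2 * Var[X; P] / 2 ≤ 1 := by
    have : t ^ 2 * Var[X; P] ≤ t ^ 2 * ε ^ 2 := by gcongr
    linarith
  have hB : ‖(1 - ((t ^ 2 * Var[X; P] / 2 : ℝ) : ℂ))
      - Complex.exp (-(t ^ 2 * Var[X; P] / 2 : ℝ))‖ ≤ t ^ 4 * ε ^ 2 * Var[X; P] := by
    have h := Real.abs_exp_sub_one_sub_id_le (x := -(t ^ 2 * Var[X; P] / 2))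
      (by rw [abs_neg, abs_of_nonneg hw0]; exact hw1)
    have e : (1 - ((t ^ 2 * Var[X; P] / 2 : ℝ) : ℂ)) - Complex.exp (-(t ^ 2 * Var[X; P] / 2 : ℝ))
        = ((-(Real.exp (-(t ^ 2 * Var[X; P] / 2)) - 1 - (-(t ^ 2 * Var[X; P] / 2))) : ℝ) : ℂ) := by
      push_cast; ring
    rw [e, Complex.norm_real, norm_neg, Real.norm_eq_abs]
    refine h.trans ?_
    have : t ^ 4 * (Var[X; P] * Var[X; P]) ≤ t ^ 4 * (ε ^ 2 * Var[X; P]) := by gcongr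
    have : 0 ≤ t ^ 4 * (Var[X; P] * Var[X; P]) := by positivity
    nlinarith
  calc _ = ‖(charFun (P.map X) t - (1 - ((t ^ 2 * Var[X; P] / 2 : ℝ) : ℂ)))
        + ((1 - ((t ^ 2 * Var[X; P] / 2 : ℝ) : ℂ))
          - Complex.exp (-(t ^ 2 * Var[X; P] / 2 : ℝ)))‖ := by congr 1; ring
    _ ≤ _ := (norm_add_le _ _).trans (by linarith)

/-- **Central limit theorem for bounded triangular arrays**: the standardized row sums of
uniformly bounded, row-wise independent random variables converge in distribution to the standard
normal law as soon as the variances of the row sums tend to infinity. -/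
theorem tendstoInDistribution_sum_of_bounded {Ω : ℕ → Type*} {mΩ : ∀ N, MeasurableSpace (Ω N)}
    {P : ∀ N, Measure (Ω N)} [∀ N, IsProbabilityMeasure (P N)] {ι : ℕ → Type*}
    [∀ N, Fintype (ι N)] {X : ∀ N, ι N → Ω N → ℝ} {C : ℝ}
    (hX : ∀ N i, AEMeasurable (X N i) (P N)) (hindep : ∀ N, iIndepFun (X N) (P N))
    (hC : ∀ N i, ∀ᵐ ω ∂(P N), |X N i ω - (P N)[X N i]| ≤ C)
    (hvar : Tendsto (fun N => ∑ i, Var[X N i; P N]) atTop atTop) :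
    TendstoInDistribution
      (fun N ω => (∑ i, X N i ω - ∑ i, (P N)[X N i]) / √(∑ i, Var[X N i; P N]))
      atTop (id : ℝ → ℝ) P (gaussianReal 0 1) where
  forall_aemeasurable N :=
    ((Finset.aemeasurable_fun_sum _ fun _ _ => hX N _).sub_const _).div_const _
  tendsto := by
    refine ProbabilityMeasure.tendsto_iff_tendsto_charFun.2 fun t => ?_
    set V : ℕ → ℝ := fun N => ∑ i, Var[X N i; P N] with hV
    set Z : ∀ N, ι N → Ω N → ℝ := fun N i ω => (√(V N))⁻¹ * (X N i ω - (P N)[X N i]) with hZ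
    have hZm : ∀ N i, AEMeasurable (Z N i) (P N) := fun N i =>
      ((hX N i).sub_const _).const_mul _
    have hsum : ∀ N, (fun ω => (∑ i, X N i ω - ∑ i, (P N)[X N i]) / √(∑ i, Var[X N i; P N]))
        = fun ω => ∑ i, Z N i ω := by
      intro N
      funext ω
      simp only [hZ, ← Finset.mul_sum, Finset.sum_sub_distrib]
      rw [div_eq_inv_mul]
    have hchar : ∀ N, charFun ((P N).map (fun ω => ∑ i, Z N i ω)) t
        = ∏ i, charFun ((P N).map (Z N i)) t := by
      intro N
      have : iIndepFun (Z N) (P N) :=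
        (hindep N).comp (fun i x => (√(V N))⁻¹ * (x - ∫ ω, X N i ω ∂(P N))) (fun i => by fun_prop)
      rw [this.charFun_map_fun_sum_eq_prod (hZm N), Finset.prod_apply]
    have hσ : Tendsto (fun N => (√(V N))⁻¹ * |C|) atTop (𝓝 0) := by
      have := (tendsto_inv_atTop_zero.comp (Real.tendsto_sqrt_atTop.comp hvar)).mul_const |C|
      simpa using this
    have hbound : ∀ᶠ N in atTop, ‖∏ i, charFun ((P N).map (Z N i)) t
        - Complex.exp (-(t ^ 2 / 2 : ℝ))‖
        ≤ |t| ^ 3 * ((√(V N))⁻¹ * |C|) + t ^ 4 * ((√(V N))⁻¹ * |C|) ^ 2 := by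
      have ht1 : ∀ᶠ N in atTop, |t| * ((√(V N))⁻¹ * |C|) < 1 := by
        have := hσ.const_mul |t|
        rw [mul_zero] at this
        exact this.eventually_lt_const one_pos
      filter_upwards [ht1, hvar.eventually_gt_atTop 0] with N ht1 hV0
      have hVarZ : ∀ i, Var[Z N i; P N] = (V N)⁻¹ * Var[X N i; P N] := by
        intro i
        simp only [hZ]
        rw [variance_const_mul, variance_sub_const (hX N i).aestronglyMeasurable, inv_pow,
          Real.sq_sqrt hV0.le]
      have hint : ∀ i, Integrable (X N i) (P N) := by
        intro i
        have : Integrable (fun ω => X N i ω - (P N)[X N i]) (P N) :=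
          Integrable.of_bound ((hX N i).sub_const _).aestronglyMeasurable C (hC N i)
        refine (this.add (integrable_const ((P N)[X N i]))).congr (.of_forall fun ω => ?_)
        simp
      have hsumV : ∑ i, Var[Z N i; P N] = 1 := by
        simp only [hVarZ, ← Finset.mul_sum]
        exact inv_mul_cancel₀ hV0.ne'
      -- Since the row variances now add up to 1, the Gaussian characteristic function splits into
      -- one factor per summand, and the products can be compared factor by factor.
      have hexp : Complex.exp (-(t ^ 2 / 2 : ℝ))
          = ∏ i, Complex.exp (-(t ^ 2 * Var[Z N i; P N] / 2 : ℝ)) := by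
        rw [← Complex.exp_sum, Finset.sum_neg_distrib, ← Complex.ofReal_sum, ← Finset.sum_div,
          ← Finset.mul_sum, hsumV, mul_one]
      rw [hexp]
      refine (norm_prod_sub_prod_le_sum _ _ _ (fun i _ => ?_) (fun i _ => ?_)).trans ?_
      · have := Measure.isProbabilityMeasure_map (hZm N i)
        exact norm_charFun_le_one _
      · rw [← Complex.ofReal_neg, ← Complex.ofReal_exp, Complex.norm_real, Real.norm_eq_abs,
          Real.abs_exp, Real.exp_le_one_iff]
        have := variance_nonneg (Z N i) (P N)
        have : 0 ≤ t ^ 2 * Var[Z N i; P N] := by positivity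
        linarith
      · calc _ ≤ ∑ i, (|t| ^ 3 * ((√(V N))⁻¹ * |C|) + t ^ 4 * ((√(V N))⁻¹ * |C|) ^ 2)
              * Var[Z N i; P N] := by
              refine Finset.sum_le_sum fun i _ => norm_charFun_map_sub_exp_le (hZm N i) ?_ ?_ ht1.le
              · simp only [hZ]
                rw [integral_const_mul, integral_sub (hint i) (integrable_const _)]
                simp
              · filter_upwards [hC N i] with ω hω
                simp only [hZ]
                rw [abs_mul, abs_of_nonneg (by positivity : (0:ℝ) ≤ (√(V N))⁻¹)]
                have := hω.trans (le_abs_self C)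
                gcongr
          _ = _ := by rw [← Finset.mul_sum, hsumV, mul_one]
    have hlim : Tendsto (fun N => |t| ^ 3 * ((√(V N))⁻¹ * |C|) + t ^ 4 * ((√(V N))⁻¹ * |C|) ^ 2)
        atTop (𝓝 0) := by
      simpa using (hσ.const_mul (|t| ^ 3)).add ((hσ.pow 2).const_mul (t ^ 4))
    have hmain : Tendsto (fun N => ∏ i, charFun ((P N).map (Z N i)) t) atTop
        (𝓝 (Complex.exp (-(t ^ 2 / 2 : ℝ)))) := by
      rw [tendsto_iff_norm_sub_tendsto_zero]
      exact squeeze_zero' (.of_forall fun _ => norm_nonneg _) hbound hlim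
    simp only [ProbabilityMeasure.coe_mk, hsum, hchar, Measure.map_id, charFun_gaussianReal]
    convert hmain using 2
    push_cast
    simp

namespace BinDecomp

/-! ### Mixed radix expansions. -/

section MixedRadix

variable {b : ℕ → ℕ}

/-- The place values of the mixed radix system with radices `b n + 1`. -/
def place (b : ℕ → ℕ) (n : ℕ) : ℕ := ∏ i ∈ Finset.range n, (b i + 1)

/-- The `n`-th digit in the mixed radix system with radices `b n + 1`. -/
def digit (b : ℕ → ℕ) (n x : ℕ) : ℕ := x / place b n % (b n + 1)

lemma place_succ (n : ℕ) : place b (n + 1) = place b n * (b n + 1) := Finset.prod_range_succ _ _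

lemma place_pos (n : ℕ) : 0 < place b n := Finset.prod_pos fun _ _ => Nat.succ_pos _

lemma place_dvd_place {m n : ℕ} (h : m ≤ n) : place b m ∣ place b n :=
  Finset.prod_dvd_prod_of_subset _ _ _ (Finset.range_mono h)

lemma place_le_place {m n : ℕ} (h : m ≤ n) : place b m ≤ place b n :=
  Nat.le_of_dvd (place_pos n) (place_dvd_place h)

lemma lt_place (hb : ∀ n, 1 ≤ b n) (n : ℕ) : n < place b n := by
  induction n with
  | zero => exact place_pos 0
  | succ n ih =>
    rw [place_succ]
    nlinarith [hb n]

lemma digit_le (n x : ℕ) : digit b n x ≤ b n := Nat.lt_succ_iff.1 (Nat.mod_lt _ (Nat.succ_pos _))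

lemma mod_place_succ (n x : ℕ) :
    x % place b (n + 1) = x % place b n + place b n * digit b n x := by
  rw [place_succ, Nat.mod_mul, digit]

lemma sum_digit_mul_place (n x : ℕ) :
    ∑ i ∈ Finset.range n, digit b i x * place b i = x % place b n := by
  induction n with
  | zero => simp [place, Nat.mod_one]
  | succ n ih => rw [Finset.sum_range_succ, ih, mod_place_succ, mul_comm]

lemma sum_mul_place_lt {c : ℕ → ℕ} {n : ℕ} (hc : ∀ i < n, c i ≤ b i) :
    ∑ i ∈ Finset.range n, c i * place b i < place b n := by
  induction n with
  | zero => simpa using place_pos 0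
  | succ n ih =>
    rw [Finset.sum_range_succ, place_succ]
    have h1 := ih fun i hi => hc i (hi.trans n.lt_succ_self)
    have h2 := Nat.mul_le_mul_right (place b n) (hc n n.lt_succ_self)
    nlinarith

/-- Every summand from index m on is divisible by `place b m`, and the remaining ones add up to less
than it. -/
lemma sum_mul_place_mod {c : ℕ → ℕ} {m n : ℕ} (hmn : m ≤ n) (hc : ∀ i < n, c i ≤ b i) :
    (∑ i ∈ Finset.range n, c i * place b i) % place b m
      = ∑ i ∈ Finset.range m, c i * place b i := by
  induction n, hmn using Nat.le_induction with
  | base => exact Nat.mod_eq_of_lt (sum_mul_place_lt hc)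
  | succ n hmn ih =>
    rw [Finset.sum_range_succ, Nat.add_mod,
      Nat.mod_eq_zero_of_dvd ((place_dvd_place hmn).mul_left _), add_zero, Nat.mod_mod]
    exact ih fun i hi => hc i (hi.trans n.lt_succ_self)

/-- Uniqueness of digits: the residues modulo two consecutive place values differ by exactly the
digit's contribution. -/
lemma digit_sum_mul_place {c : ℕ → ℕ} {i n : ℕ} (hi : i < n) (hc : ∀ i < n, c i ≤ b i) :
    digit b i (∑ j ∈ Finset.range n, c j * place b j) = c i := by
  have h := mod_place_succ (b := b) i (∑ j ∈ Finset.range n, c j * place b j)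
  rw [sum_mul_place_mod hi hc, sum_mul_place_mod hi.le hc, Finset.sum_range_succ,
    mul_comm (place b i)] at h
  exact (Nat.eq_of_mul_eq_mul_right (place_pos i) (Nat.add_left_cancel h)).symm

end MixedRadix

/-! ### Bins, and legal sets as digit vectors. -/

section Bins

variable {b : ℕ → ℕ}

lemma binStart_succ (n : ℕ) : binStart b (n + 1) = binStart b n + b n := Finset.sum_range_succ _ _

lemma binStart_mono : Monotone (binStart b) :=
  monotone_nat_of_le_succ fun n => by rw [binStart_succ]; omega

lemma mem_bin {n k : ℕ} : k ∈ bin b n ↔ binStart b n ≤ k ∧ k < binStart b n + b n := by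
  rw [bin, Finset.mem_Ico, binStart_succ]

lemma le_binStart (hb : ∀ n, 1 ≤ b n) (n : ℕ) : n ≤ binStart b n := by
  induction n with
  | zero => exact Nat.zero_le _
  | succ n ih => rw [binStart_succ]; have := hb n; omega

/-- The bin that contains the position `k`. -/
def binOf (b : ℕ → ℕ) (k : ℕ) : ℕ := Nat.findGreatest (fun n => binStart b n ≤ k) k

/-- The search for the bin of k may stop at k, because bins are non-empty and so bin n starts at
position n or later. -/
lemma mem_bin_binOf (hb : ∀ n, 1 ≤ b n) (k : ℕ) : k ∈ bin b (binOf b k) := by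
  rw [bin, Finset.mem_Ico]
  refine ⟨Nat.findGreatest_spec (P := fun n => binStart b n ≤ k) (Nat.zero_le k)
    (by simp [binStart]), ?_⟩
  by_contra! h
  have h1 : binOf b k + 1 ≤ k := (le_binStart hb _).trans h
  have h2 : binOf b k + 1 ≤ binOf b k :=
    Nat.le_findGreatest (P := fun n => binStart b n ≤ k) h1 h
  omega

lemma eq_of_mem_bin {m n k : ℕ} (hm : k ∈ bin b m) (hn : k ∈ bin b n) : m = n := by
  rw [bin, Finset.mem_Ico] at hm hn
  rcases lt_trichotomy m n with h | h | h
  · have := binStart_mono (b := b) (Nat.succ_le_of_lt h); simp at this; omega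
  · exact h
  · have := binStart_mono (b := b) (Nat.succ_le_of_lt h); simp at this; omega

lemma mem_bin_iff (hb : ∀ n, 1 ≤ b n) {n k : ℕ} : k ∈ bin b n ↔ binOf b k = n :=
  ⟨fun h => eq_of_mem_bin (mem_bin_binOf hb k) h, fun h => h ▸ mem_bin_binOf hb k⟩

/-- The closed form of the term at position `k`. -/
def binTerm (b : ℕ → ℕ) (k : ℕ) : ℕ := (k - binStart b (binOf b k) + 1) * place b (binOf b k)

lemma binTerm_of_mem (hb : ∀ n, 1 ≤ b n) {n k : ℕ} (h : k ∈ bin b n) :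
    binTerm b k = (k - binStart b n + 1) * place b n := by
  rw [binTerm, (mem_bin_iff hb).1 h]

lemma place_le_binTerm (k : ℕ) : place b (binOf b k) ≤ binTerm b k :=
  Nat.le_mul_of_pos_left _ (Nat.succ_pos _)

lemma binTerm_lt_place (hb : ∀ n, 1 ≤ b n) (k : ℕ) : binTerm b k < place b (binOf b k + 1) := by
  have h := mem_bin.1 (mem_bin_binOf hb k)
  rw [binTerm, place_succ, mul_comm]
  exact Nat.mul_lt_mul_of_pos_left (by omega) (place_pos _)

/-- The rank inside bin `n`, counted from `1`, of the position that `D` has in bin `n`; it is `0`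
if there is none. -/
def rank (b : ℕ → ℕ) (D : Finset ℕ) (n : ℕ) : ℕ := ∑ k ∈ D ∩ bin b n, (k - binStart b n + 1)

/-- For a = 0 the spacing condition says only m < n, so it is vacuous. -/
lemma isLegal_zeroOne_iff {D : Finset ℕ} :
    IsLegal b zeroOne 0 D ↔ ∀ n, (D ∩ bin b n).card ≤ 1 := by
  have h : ∀ n : ℕ, n ∈ ({0, 1} : Set ℕ) ↔ n ≤ 1 := fun n => by
    simp only [Set.mem_insert_iff, Set.mem_singleton_iff]; omega
  refine ⟨fun H n => (h _).1 (H.1 n), fun H => ⟨fun n => (h _).2 (H n), ?_⟩⟩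
  intro m n hmn _ _
  simpa using hmn

lemma rank_eq_zero_iff {D : Finset ℕ} {n : ℕ} : rank b D n = 0 ↔ D ∩ bin b n = ∅ := by
  simp [rank, Finset.sum_eq_zero_iff, Finset.eq_empty_iff_forall_notMem]

lemma IsLegal.inter_bin_eq {D : Finset ℕ} (hD : IsLegal b zeroOne 0 D) {n k : ℕ}
    (hk : k ∈ D) (hkn : k ∈ bin b n) : D ∩ bin b n = {k} :=
  Finset.card_le_one_iff_subset_singleton.1 (isLegal_zeroOne_iff.1 hD n) |>.elim fun y hy => by
    have hmem : k ∈ D ∩ bin b n := Finset.mem_inter.2 ⟨hk, hkn⟩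
    have : k = y := Finset.mem_singleton.1 (hy hmem)
    subst this
    exact Finset.Subset.antisymm hy (Finset.singleton_subset_iff.2 hmem)

lemma IsLegal.rank_eq {D : Finset ℕ} (hD : IsLegal b zeroOne 0 D) {n k : ℕ}
    (hk : k ∈ D) (hkn : k ∈ bin b n) : rank b D n = k - binStart b n + 1 := by
  rw [rank, hD.inter_bin_eq hk hkn, Finset.sum_singleton]

lemma IsLegal.rank_le {D : Finset ℕ} (hD : IsLegal b zeroOne 0 D) (n : ℕ) : rank b D n ≤ b n := by
  rcases (D ∩ bin b n).eq_empty_or_nonempty with h | ⟨k, hk⟩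
  · rw [rank_eq_zero_iff.2 h]; exact Nat.zero_le _
  · obtain ⟨hk, hkn⟩ := Finset.mem_inter.1 hk
    rw [hD.rank_eq hk hkn]
    have := mem_bin.1 hkn
    omega

lemma IsLegal.mem_iff {D : Finset ℕ} (hD : IsLegal b zeroOne 0 D) {n k : ℕ} (hkn : k ∈ bin b n) :
    k ∈ D ↔ rank b D n = k - binStart b n + 1 := by
  refine ⟨fun hk => hD.rank_eq hk hkn, fun h => ?_⟩
  have hne : (D ∩ bin b n).Nonempty := by
    rw [Finset.nonempty_iff_ne_empty, Ne, ← rank_eq_zero_iff]; omega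
  obtain ⟨j, hj⟩ := hne
  obtain ⟨hj, hjn⟩ := Finset.mem_inter.1 hj
  rw [hD.rank_eq hj hjn] at h
  have h1 := mem_bin.1 hjn
  have h2 := mem_bin.1 hkn
  have : j = k := by omega
  exact this ▸ hj

lemma IsLegal.ext (hb : ∀ n, 1 ≤ b n) {D E : Finset ℕ} (hD : IsLegal b zeroOne 0 D)
    (hE : IsLegal b zeroOne 0 E) (h : ∀ n, rank b D n = rank b E n) : D = E := by
  ext k
  rw [hD.mem_iff (mem_bin_binOf hb k), hE.mem_iff (mem_bin_binOf hb k), h]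

lemma filter_binOf_eq (hb : ∀ n, 1 ≤ b n) (D : Finset ℕ) (n : ℕ) :
    D.filter (fun k => binOf b k = n) = D ∩ bin b n := by
  ext k
  simp [mem_bin_iff hb]

/-- The bridge to mixed radix: grouping summands by bin makes the ranks the digits. For legal sets
these are admissible digits by `IsLegal.rank_le`. -/
lemma sum_binTerm_eq (hb : ∀ n, 1 ≤ b n) {D : Finset ℕ} {M : ℕ} (hM : ∀ k ∈ D, binOf b k < M) :
    ∑ k ∈ D, binTerm b k = ∑ n ∈ Finset.range M, rank b D n * place b n := by
  rw [← Finset.sum_fiberwise_of_maps_to (g := binOf b) fun k hk => Finset.mem_range.2 (hM k hk)]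
  refine Finset.sum_congr rfl fun n _ => ?_
  rw [filter_binOf_eq hb, rank, Finset.sum_mul]
  exact Finset.sum_congr rfl fun k hk => binTerm_of_mem hb (Finset.mem_inter.1 hk).2

/-- The set of positions with prescribed ranks `c n` in the bins `n < M`. -/
def ofRanks (b c : ℕ → ℕ) (M : ℕ) : Finset ℕ :=
  ((Finset.range M).filter fun n => c n ≠ 0).image fun n => binStart b n + c n - 1

lemma mem_ofRanks {c : ℕ → ℕ} {M k : ℕ} :
    k ∈ ofRanks b c M ↔ ∃ n < M, c n ≠ 0 ∧ binStart b n + c n - 1 = k := by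
  simp [ofRanks, and_assoc]

lemma mem_bin_of_rank {n r : ℕ} (hr : r ≠ 0) (hrb : r ≤ b n) : binStart b n + r - 1 ∈ bin b n := by
  rw [mem_bin]; omega

lemma ofRanks_inter_bin {c : ℕ → ℕ} {M : ℕ} (hc : ∀ n, c n ≤ b n) {n : ℕ} (hn : n < M) :
    ofRanks b c M ∩ bin b n = if c n = 0 then ∅ else {binStart b n + c n - 1} := by
  ext k
  rw [Finset.mem_inter, mem_ofRanks]
  constructor
  · rintro ⟨⟨m, hm, h0, rfl⟩, hk⟩
    obtain rfl := eq_of_mem_bin (mem_bin_of_rank h0 (hc m)) hk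
    simp [h0]
  · split_ifs with h
    · simp
    · rintro hk
      rw [Finset.mem_singleton] at hk
      exact ⟨⟨n, hn, h, hk.symm⟩, hk ▸ mem_bin_of_rank h (hc n)⟩

lemma binOf_lt_of_mem_ofRanks (hb : ∀ n, 1 ≤ b n) {c : ℕ → ℕ} {M : ℕ} (hc : ∀ n, c n ≤ b n) {k : ℕ}
    (hk : k ∈ ofRanks b c M) : binOf b k < M := by
  obtain ⟨m, hm, h0, rfl⟩ := mem_ofRanks.1 hk
  rwa [(mem_bin_iff hb).1 (mem_bin_of_rank h0 (hc m))]

lemma isLegal_ofRanks (hb : ∀ n, 1 ≤ b n) {c : ℕ → ℕ} {M : ℕ} (hc : ∀ n, c n ≤ b n) :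
    IsLegal b zeroOne 0 (ofRanks b c M) := by
  rw [isLegal_zeroOne_iff]
  intro n
  by_cases hn : n < M
  · rw [ofRanks_inter_bin hc hn]
    split_ifs <;> simp
  · rw [Finset.card_eq_zero.2]
    · exact Nat.zero_le _
    · refine Finset.eq_empty_of_forall_notMem fun k hk => hn ?_
      obtain ⟨hk, hkn⟩ := Finset.mem_inter.1 hk
      rw [← (mem_bin_iff hb).1 hkn]
      exact binOf_lt_of_mem_ofRanks hb hc hk

lemma rank_ofRanks {c : ℕ → ℕ} {M : ℕ} (hc : ∀ n, c n ≤ b n) {n : ℕ} (hn : n < M) :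
    rank b (ofRanks b c M) n = c n := by
  rw [rank, ofRanks_inter_bin hc hn]
  split_ifs with h
  · simp [h]
  · rw [Finset.sum_singleton]; omega

lemma sum_binTerm_ofRanks_digit (hb : ∀ n, 1 ≤ b n) {M x : ℕ} (hx : x < place b M) :
    ∑ k ∈ ofRanks b (fun n => digit b n x) M, binTerm b k = x := by
  have hc : ∀ n, digit b n x ≤ b n := fun n => digit_le n x
  rw [sum_binTerm_eq hb fun k hk => binOf_lt_of_mem_ofRanks hb hc hk]
  rw [Finset.sum_congr rfl fun n hn => by rw [rank_ofRanks hc (Finset.mem_range.1 hn)],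
    sum_digit_mul_place, Nat.mod_eq_of_lt hx]

/-! ### Closed form of the sequence, and its decompositions. -/

/-- The terms of the `({b_n}, {0, 1}, 0)`-sequence in bin `n` are the first `b n` multiples of the
`n`-th place value. -/
theorem binSeq_eq_binTerm (hb : ∀ n, 1 ≤ b n) (k : ℕ) : binSeq b zeroOne 0 k = binTerm b k := by
  induction k using Nat.strong_induction_on with
  | _ k ih =>
  have hk := mem_bin_binOf hb k
  set n := binOf b k with hn
  have hk' := mem_bin.1 hk
  refine (binSeq_isLeast b zeroOne 0 k).unique ⟨⟨?_, fun D hD => ?_⟩, fun m hm => ?_⟩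
  · exact (place_pos _).trans_le (place_le_binTerm k)
  · have hsum : ∑ i ∈ D, binSeq b zeroOne 0 i.val
        = ∑ i ∈ D.map Fin.valEmbedding, binTerm b i := by
      rw [Finset.sum_map]
      exact Finset.sum_congr rfl fun i _ => ih i.val i.isLt
    have hlt : ∀ i ∈ D.map Fin.valEmbedding, i < k := by
      intro i hi
      obtain ⟨j, -, rfl⟩ := Finset.mem_map.1 hi
      exact j.isLt
    have hbin : ∀ i ∈ D.map Fin.valEmbedding, binOf b i < n + 1 := by
      intro i hi
      by_contra! h
      have h1 := mem_bin.1 (mem_bin_binOf hb i)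
      have h2 := binStart_mono (b := b) h
      rw [binStart_succ] at h2
      have := hlt i hi
      omega
    -- Only positions before k are available, so the digit in bin n is smaller than that of the
    -- candidate; the lower digits together stay below `place b n` and cannot make up for it.
    have hr : rank b (D.map Fin.valEmbedding) n ≤ k - binStart b n := by
      rcases (D.map Fin.valEmbedding ∩ bin b n).eq_empty_or_nonempty with h | ⟨i, hi⟩
      · rw [rank_eq_zero_iff.2 h]; exact Nat.zero_le _
      · obtain ⟨hi, hin⟩ := Finset.mem_inter.1 hi
        rw [hD.rank_eq hi hin]
        have := mem_bin.1 hin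
        have := hlt i hi
        omega
    rw [hsum, sum_binTerm_eq hb hbin, Finset.sum_range_succ, binTerm_of_mem hb hk]
    have h1 := sum_mul_place_lt (b := b) (n := n) fun i _ => hD.rank_le i
    have h2 := Nat.mul_le_mul_right (place b n) hr
    rw [add_mul, one_mul]
    omega
  -- A smaller m is already represented: its digit expansion uses only positions before k, because
  -- its digit in place n is at most `k - binStart b n` and rank r sits at offset r - 1.
  · by_contra! hlt
    have hmk : m < (k - binStart b n + 1) * place b n := by rwa [← binTerm_of_mem hb hk]
    have hmp : m < place b (n + 1) := hlt.trans (binTerm_lt_place hb k)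
    have hdn : digit b n m ≤ k - binStart b n :=
      (Nat.mod_le _ _).trans (Nat.lt_succ_iff.1 (Nat.div_lt_of_lt_mul (by rwa [mul_comm])))
    set E := ofRanks b (fun i => digit b i m) (n + 1) with hE
    have hEk : ∀ i ∈ E, i < k := by
      intro i hi
      obtain ⟨j, hj, h0, rfl⟩ := mem_ofRanks.1 hi
      rcases Nat.lt_succ_iff_lt_or_eq.1 hj with h | rfl
      · have h1 := mem_bin.1 (mem_bin_of_rank h0 (digit_le j m))
        have h2 := binStart_mono (b := b) (Nat.succ_le_of_lt h)
        rw [Nat.succ_eq_add_one, binStart_succ] at h2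
        omega
      · omega
    refine hm.2 (E.attachFin hEk) ?_ ?_
    · rw [Finset.map_valEmbedding_attachFin]
      exact isLegal_ofRanks hb fun i => digit_le i m
    · have : ∑ i ∈ E.attachFin hEk, binSeq b zeroOne 0 i.val
          = ∑ i ∈ (E.attachFin hEk).map Fin.valEmbedding, binTerm b i := by
        rw [Finset.sum_map]
        exact Finset.sum_congr rfl fun i _ => ih i.val i.isLt
      rw [this, Finset.map_valEmbedding_attachFin, sum_binTerm_ofRanks_digit hb hmp]

lemma isDecomposition_iff (hb : ∀ n, 1 ≤ b n) {D : Finset ℕ} {x : ℕ} :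
    IsDecomposition b zeroOne 0 D x ↔ IsLegal b zeroOne 0 D ∧ ∑ k ∈ D, binTerm b k = x := by
  simp only [IsDecomposition, binSeq_eq_binTerm hb]

lemma exists_isDecomposition (hb : ∀ n, 1 ≤ b n) (x : ℕ) :
    ∃ D, IsDecomposition b zeroOne 0 D x :=
  ⟨ofRanks b (fun n => digit b n x) x, (isDecomposition_iff hb).2
    ⟨isLegal_ofRanks hb fun n => digit_le n x, sum_binTerm_ofRanks_digit hb (lt_place hb x)⟩⟩

lemma IsDecomposition.rank_eq_digit (hb : ∀ n, 1 ≤ b n) {D : Finset ℕ} {x : ℕ}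
    (hD : IsDecomposition b zeroOne 0 D x) (n : ℕ) : rank b D n = digit b n x := by
  obtain ⟨hl, rfl⟩ := (isDecomposition_iff hb).1 hD
  -- The bound exceeds every bin used by `D` and also n itself, so that digit n is among the digits
  -- summed even when `D` misses bin n.
  have hM : ∀ k ∈ D, binOf b k < D.sup (binOf b) + n + 1 := fun k hk => by
    have := Finset.le_sup (f := binOf b) hk
    omega
  rw [sum_binTerm_eq hb hM, digit_sum_mul_place (by omega) fun i _ => hl.rank_le i]

lemma IsDecomposition.unique (hb : ∀ n, 1 ≤ b n) {D E : Finset ℕ} {x : ℕ}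
    (hD : IsDecomposition b zeroOne 0 D x) (hE : IsDecomposition b zeroOne 0 E x) : D = E :=
  hD.1.ext hb hE.1 fun n => by rw [hD.rank_eq_digit hb, hE.rank_eq_digit hb]

lemma isDecomposition_decomposition (hb : ∀ n, 1 ≤ b n) (x : ℕ) :
    IsDecomposition b zeroOne 0 (decomposition b zeroOne 0 x) x := by
  have h := exists_isDecomposition hb x
  rw [decomposition, dif_pos h]
  exact h.choose_spec

lemma decomposition_inter_bin_nonempty_iff (hb : ∀ n, 1 ≤ b n) (n x : ℕ) :
    (decomposition b zeroOne 0 x ∩ bin b n).Nonempty ↔ digit b n x ≠ 0 := by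
  rw [← (isDecomposition_decomposition hb x).rank_eq_digit hb, Ne, rank_eq_zero_iff,
    Finset.nonempty_iff_ne_empty]

lemma usesBin_eq (hb : ∀ n, 1 ≤ b n) (n x : ℕ) :
    usesBin b zeroOne 0 n x = if digit b n x = 0 then 0 else 1 := by
  simp only [usesBin, decomposition_inter_bin_nonempty_iff hb]
  split_ifs <;> simp_all

lemma card_inter_bin_eq_usesBin (hb : ∀ n, 1 ≤ b n) (n x : ℕ) :
    ((decomposition b zeroOne 0 x ∩ bin b n).card : ℝ) = usesBin b zeroOne 0 n x := by
  have h := isLegal_zeroOne_iff.1 (isDecomposition_decomposition hb x).1 n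
  rw [usesBin]
  split_ifs with h0
  · have := h0.card_pos
    have : (decomposition b zeroOne 0 x ∩ bin b n).card = 1 := by omega
    simp [this]
  · simp [Finset.not_nonempty_iff_eq_empty.1 h0]

lemma binOf_lt_of_lt_place (hb : ∀ n, 1 ≤ b n) {M x : ℕ} (hx : x < place b M) {k : ℕ}
    (hk : k ∈ decomposition b zeroOne 0 x) : binOf b k < M := by
  by_contra! h
  have h1 := ((isDecomposition_iff hb).1 (isDecomposition_decomposition hb x)).2
  have h2 := Finset.single_le_sum (f := binTerm b) (fun _ _ => Nat.zero_le _) hk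
  have h3 := place_le_binTerm (b := b) k
  have h4 := place_le_place (b := b) h
  omega

lemma numSummands_eq_sum (hb : ∀ n, 1 ≤ b n) {M x : ℕ} (hx : x < place b M) :
    (numSummands b zeroOne 0 x : ℝ) = ∑ n ∈ Finset.range M, usesBin b zeroOne 0 n x := by
  rw [numSummands, Finset.card_eq_sum_card_fiberwise (f := binOf b) (t := Finset.range M)
    fun k hk => by simpa using binOf_lt_of_lt_place hb hx hk]
  push_cast
  exact Finset.sum_congr rfl fun n _ => by
    rw [filter_binOf_eq hb, card_inter_bin_eq_usesBin hb]

/-- The integers whose largest summand lies in bin `N` form an interval. -/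
theorem largestInBin_eq (hb : ∀ n, 1 ≤ b n) (N : ℕ) :
    largestInBin b zeroOne 0 N = Set.Ico (place b N) (place b (N + 1)) := by
  ext x
  have hdec := isDecomposition_decomposition hb x
  have hsum := ((isDecomposition_iff hb).1 hdec).2
  have hle : ∀ k ∈ decomposition b zeroOne 0 x, binTerm b k ≤ x := fun k hk => by
    have := Finset.single_le_sum (f := binTerm b) (fun _ _ => Nat.zero_le _) hk
    omega
  simp only [largestInBin, Set.mem_ofPred_eq, Set.mem_Ico, binSeq_eq_binTerm hb]
  constructor
  · rintro ⟨k, hk, hkN, hmax⟩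
    have hkN' := (mem_bin_iff hb).1 hkN
    refine ⟨hkN' ▸ (place_le_binTerm k).trans (hle k hk), ?_⟩
    -- Every term of a later bin is at least `place b (N + 1)`, which exceeds the maximal summand.
    have hM : ∀ j ∈ decomposition b zeroOne 0 x, binOf b j < N + 1 := by
      intro j hj
      by_contra! h
      have h1 := place_le_place (b := b) h
      have h2 := place_le_binTerm (b := b) j
      have h3 := binTerm_lt_place hb k
      have h4 := hmax j hj
      rw [hkN'] at h3
      omega
    rw [← hsum, sum_binTerm_eq hb hM]
    exact sum_mul_place_lt fun i _ => hdec.1.rank_le i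
  · rintro ⟨h1, h2⟩
    have hd : digit b N x ≠ 0 := by
      rw [digit, Nat.mod_eq_of_lt (Nat.div_lt_of_lt_mul (by rwa [← place_succ]))]
      exact (Nat.div_pos h1 (place_pos N)).ne'
    obtain ⟨k, hk⟩ := (decomposition_inter_bin_nonempty_iff hb N x).2 hd
    obtain ⟨hk, hkN⟩ := Finset.mem_inter.1 hk
    refine ⟨k, hk, hkN, fun j hj => ?_⟩
    have hkN' := (mem_bin_iff hb).1 hkN
    -- A summand in an earlier bin lies below `place b N`; one in bin N is k itself, by legality.
    rcases Nat.lt_succ_iff_lt_or_eq.1 (binOf_lt_of_lt_place hb h2 hj) with h | h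
    · have h3 := binTerm_lt_place hb j
      have h4 := place_le_place (b := b) (Nat.succ_le_of_lt h)
      have h5 := place_le_binTerm (b := b) k
      rw [hkN'] at h5
      exact (h3.le.trans h4).trans h5
    · have hjN := (mem_bin_iff hb).2 h
      have := hdec.1.inter_bin_eq hk hkN
      have hj' : j ∈ decomposition b zeroOne 0 x ∩ bin b N := Finset.mem_inter.2 ⟨hj, hjN⟩
      rw [this, Finset.mem_singleton] at hj'
      rw [hj']

end Bins

end BinDecomp

namespace BinDecomp

/-! ### Joint law of the digits and of the bin indicators. -/

section Law

variable {b : ℕ → ℕ}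

/-- The possible values of the digit `i` of an integer whose leading digit has index `N`. -/
def digitRange (b : ℕ → ℕ) (N i : ℕ) : Finset ℕ :=
  if i = N then Finset.Icc 1 (b N) else Finset.range (b i + 1)

lemma le_of_mem_digitRange {N i d : ℕ} (h : d ∈ digitRange b N i) : d ≤ b i := by
  rw [digitRange] at h
  split_ifs at h with hi
  · subst hi; exact (Finset.mem_Icc.1 h).2
  · exact Nat.lt_succ_iff.1 (Finset.mem_range.1 h)

lemma digit_mem_digitRange {N x : ℕ} (hx : x ∈ Set.Ico (place b N) (place b (N + 1))) (i : ℕ) :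
    digit b i x ∈ digitRange b N i := by
  rw [digitRange]
  split_ifs with hi
  · subst hi
    refine Finset.mem_Icc.2 ⟨?_, digit_le i x⟩
    rw [digit, Nat.mod_eq_of_lt (Nat.div_lt_of_lt_mul (by rw [← place_succ]; exact hx.2))]
    exact Nat.div_pos hx.1 (place_pos i)
  · exact Finset.mem_range.2 (Nat.lt_succ_iff.2 (digit_le i x))

lemma digitRange_nonempty (hb : ∀ n, 1 ≤ b n) (N i : ℕ) : (digitRange b N i).Nonempty := by
  rw [digitRange]
  split_ifs
  · exact Finset.nonempty_Icc.2 (hb N)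
  · exact Finset.nonempty_range_iff.2 (Nat.succ_ne_zero _)

/-- Matches the normalising constants of the two uniform laws: the leading digit has b N values
rather than b N + 1. -/
lemma prod_card_digitRange (N : ℕ) :
    ∏ i : Fin (N + 1), (digitRange b N i).card = place b (N + 1) - place b N := by
  rw [Fin.prod_univ_eq_prod_range (fun i => (digitRange b N i).card), Finset.prod_range_succ,
    place_succ, mul_add, mul_one, Nat.add_sub_cancel]
  congr 1
  · refine Finset.prod_congr rfl fun i hi => ?_
    rw [digitRange, if_neg (Finset.mem_range.1 hi).ne, Finset.card_range]
  · rw [digitRange, if_pos rfl, Nat.card_Icc, Nat.add_sub_cancel]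

lemma uniformOn_finset_singleton (A : Finset ℕ) (a : ℕ) :
    uniformOn (A : Set ℕ) {a} = if a ∈ A then (A.card : ENNReal)⁻¹ else 0 := by
  rw [← Finset.coe_singleton, uniformOn_apply_finset]
  split_ifs with h
  · rw [Finset.inter_singleton_of_mem h, Finset.card_singleton, Nat.cast_one, one_div]
  · rw [Finset.inter_singleton_of_notMem h]; simp

lemma isProbabilityMeasure_uniformOn_digitRange (hb : ∀ n, 1 ≤ b n) (N i : ℕ) :
    IsProbabilityMeasure (uniformOn (digitRange b N i : Set ℕ)) :=
  isProbabilityMeasure_uniformOn (Finset.finite_toSet _) (digitRange_nonempty hb N i)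

lemma largestInBin_nonempty (hb : ∀ n, 1 ≤ b n) (N : ℕ) :
    (largestInBin b zeroOne 0 N).Nonempty := by
  rw [largestInBin_eq hb, Set.nonempty_Ico, place_succ]
  have := place_pos (b := b) N
  nlinarith [hb N]

lemma largestInBin_finite (hb : ∀ n, 1 ≤ b n) (N : ℕ) : (largestInBin b zeroOne 0 N).Finite := by
  rw [largestInBin_eq hb]
  exact Set.finite_Ico _ _

lemma isProbabilityMeasure_unifLaw (hb : ∀ n, 1 ≤ b n) (N : ℕ) :
    IsProbabilityMeasure (unifLaw b zeroOne 0 N) :=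
  isProbabilityMeasure_uniformOn (largestInBin_finite hb N) (largestInBin_nonempty hb N)

lemma ae_mem_largestInBin (hb : ∀ n, 1 ≤ b n) (N : ℕ) :
    ∀ᵐ x ∂(unifLaw b zeroOne 0 N), x ∈ largestInBin b zeroOne 0 N :=
  ae_cond_mem (largestInBin_finite hb N).measurableSet

/-- An admissible digit vector is attained by exactly one integer of the interval, so the digit map
carries the uniform law to a uniform law. -/
lemma inter_preimage_digits_eq {N : ℕ} {c : Fin (N + 1) → ℕ}
    (hc : ∀ i : Fin (N + 1), c i ∈ digitRange b N i) :
    ∃ x, Set.Ico (place b N) (place b (N + 1)) ∩ {y | (fun i : Fin (N + 1) => digit b i y) = c}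
      = {x} := by
  set e : ℕ → ℕ := fun n => if h : n < N + 1 then c ⟨n, h⟩ else 0 with he
  have hec : ∀ i : Fin (N + 1), e i = c i := fun i => dif_pos i.isLt
  have heb : ∀ n < N + 1, e n ≤ b n := fun n hn => by
    rw [hec ⟨n, hn⟩]
    exact le_of_mem_digitRange (hc ⟨n, hn⟩)
  refine ⟨∑ n ∈ Finset.range (N + 1), e n * place b n, ?_⟩
  ext y
  simp only [Set.mem_inter_iff, Set.mem_ofPred_eq, Set.mem_singleton_iff]
  constructor
  · rintro ⟨hy, rfl⟩
    rw [← Nat.mod_eq_of_lt hy.2, ← sum_digit_mul_place]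
    refine Finset.sum_congr rfl fun n hn => ?_
    rw [hec ⟨n, Finset.mem_range.1 hn⟩]
  · rintro rfl
    refine ⟨⟨?_, sum_mul_place_lt heb⟩, funext fun i => ?_⟩
    -- The leading digit is non-zero, which puts the integer at or above `place b N`.
    · have h1 : 1 ≤ e N := by
        have := hc (Fin.last N)
        rw [digitRange, Fin.val_last, if_pos rfl, Finset.mem_Icc, ← hec] at this
        simpa using this.1
      refine (Nat.le_mul_of_pos_left _ h1).trans ?_
      exact Finset.single_le_sum (f := fun n => e n * place b n) (fun _ _ => Nat.zero_le _)
        (Finset.self_mem_range_succ N)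
    · rw [digit_sum_mul_place i.isLt heb, hec]

/-- The digits of a uniformly random integer with leading digit of index `N` are jointly uniform. -/
theorem map_digits_unifLaw (hb : ∀ n, 1 ≤ b n) (N : ℕ) :
    (unifLaw b zeroOne 0 N).map (fun x (i : Fin (N + 1)) => digit b i x)
      = Measure.pi fun i : Fin (N + 1) => uniformOn (digitRange b N i : Set ℕ) := by
  have := fun i : Fin (N + 1) => isProbabilityMeasure_uniformOn_digitRange hb N i
  refine Measure.ext_of_singleton fun c => ?_
  rw [Measure.pi_singleton, Measure.map_apply (measurable_of_countable _)
    (measurableSet_singleton c), unifLaw, largestInBin_eq hb, uniformOn,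
    cond_apply measurableSet_Ico]
  change _ * Measure.count (_ ∩ {y | (fun i : Fin (N + 1) => digit b i y) = c}) = _
  simp only [uniformOn_finset_singleton]
  by_cases hc : ∀ i : Fin (N + 1), c i ∈ digitRange b N i
  · obtain ⟨x, hx⟩ := inter_preimage_digits_eq hc
    rw [hx, Measure.count_singleton, mul_one, ← Finset.coe_Ico, Measure.count_apply_finset,
      Nat.card_Ico, ← prod_card_digitRange, Nat.cast_prod,
      ENNReal.prod_inv_distrib fun i _ j _ _ => Or.inr (ENNReal.natCast_ne_top _)]
    exact Finset.prod_congr rfl fun i _ => by rw [if_pos (hc i)]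
  -- An inadmissible vector has mass 0 on both sides: one factor of the product vanishes, and no
  -- integer of the interval has these digits.
  · obtain ⟨i, hi⟩ := not_forall.1 hc
    rw [Finset.prod_eq_zero (Finset.mem_univ i) (if_neg hi)]
    have : Set.Ico (place b N) (place b (N + 1))
        ∩ {y | (fun i : Fin (N + 1) => digit b i y) = c} = ∅ := by
      refine Set.eq_empty_of_forall_notMem fun y hy => hi ?_
      have h := congrFun (show (fun i : Fin (N + 1) => digit b i y) = c from hy.2) i
      exact h ▸ digit_mem_digitRange hy.1 i
    rw [this]
    simp

lemma map_digit_unifLaw (hb : ∀ n, 1 ≤ b n) (N : ℕ) (i : Fin (N + 1)) :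
    (unifLaw b zeroOne 0 N).map (digit b i) = uniformOn (digitRange b N i : Set ℕ) := by
  have := fun i : Fin (N + 1) => isProbabilityMeasure_uniformOn_digitRange hb N i
  have h := (measurePreserving_eval
    (fun i : Fin (N + 1) => uniformOn (digitRange b N i : Set ℕ)) i).map_eq
  rw [← map_digits_unifLaw hb, Measure.map_map (measurable_pi_apply i)
    (measurable_of_countable _)] at h
  exact h

lemma iIndepFun_digit (hb : ∀ n, 1 ≤ b n) (N : ℕ) :
    iIndepFun (fun i : Fin (N + 1) => digit b i) (unifLaw b zeroOne 0 N) := by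
  have := isProbabilityMeasure_unifLaw hb N
  rw [iIndepFun_iff_map_fun_eq_pi_map fun i => (measurable_of_countable _).aemeasurable,
    map_digits_unifLaw hb]
  simp only [map_digit_unifLaw hb]

lemma iIndepFun_usesBin (hb : ∀ n, 1 ≤ b n) (N : ℕ) :
    iIndepFun (fun n : Fin (N + 1) => usesBin b zeroOne 0 n) (unifLaw b zeroOne 0 N) := by
  have h := (iIndepFun_digit hb N).comp (fun _ d => if d = 0 then (0 : ℝ) else 1)
    fun _ => measurable_of_countable _
  convert h using 2 with n
  funext x
  exact usesBin_eq hb n x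

lemma real_usesBin_eq_zero (hb : ∀ n, 1 ≤ b n) {n N : ℕ} (hn : n < N) :
    (unifLaw b zeroOne 0 N).real {x | usesBin b zeroOne 0 n x = 0} = 1 / (b n + 1) := by
  have hset : {x | usesBin b zeroOne 0 n x = 0} = digit b n ⁻¹' {0} := by
    ext x
    simp [usesBin_eq hb]
  have h := map_digit_unifLaw hb N ⟨n, hn.trans N.lt_succ_self⟩
  rw [hset, ← map_measureReal_apply (measurable_of_countable _) (measurableSet_singleton 0), h,
    measureReal_def, uniformOn_finset_singleton, digitRange, if_neg hn.ne, if_pos (by simp),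
    Finset.card_range, ENNReal.toReal_inv, ENNReal.toReal_natCast]
  simp

lemma usesBin_eq_zero_or_one (n x : ℕ) :
    usesBin b zeroOne 0 n x = 0 ∨ usesBin b zeroOne 0 n x = 1 := by
  rw [usesBin]
  split_ifs <;> simp

lemma real_usesBin_eq_one (hb : ∀ n, 1 ≤ b n) {n N : ℕ} (hn : n < N) :
    (unifLaw b zeroOne 0 N).real {x | usesBin b zeroOne 0 n x = 1} = b n / (b n + 1) := by
  have := isProbabilityMeasure_unifLaw hb N
  have hset : {x | usesBin b zeroOne 0 n x = 1} = {x | usesBin b zeroOne 0 n x = 0}ᶜ := by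
    ext x
    rcases usesBin_eq_zero_or_one (b := b) n x with h | h <;> simp [h]
  rw [hset, probReal_compl_eq_one_sub (Set.to_countable _).measurableSet,
    real_usesBin_eq_zero hb hn]
  field_simp
  ring

lemma usesBin_largest {N x : ℕ} (hx : x ∈ largestInBin b zeroOne 0 N) :
    usesBin b zeroOne 0 N x = 1 := by
  obtain ⟨k, hk, hkN, -⟩ := hx
  rw [usesBin, if_pos ⟨k, Finset.mem_inter.2 ⟨hk, hkN⟩⟩]

lemma numSummands_eq_of_mem (hb : ∀ n, 1 ≤ b n) {N x : ℕ}
    (hx : x ∈ largestInBin b zeroOne 0 N) :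
    (numSummands b zeroOne 0 x : ℝ) = ∑ n ∈ Finset.range (N + 1), usesBin b zeroOne 0 n x := by
  rw [largestInBin_eq hb] at hx
  exact numSummands_eq_sum hb hx.2

/-! ### Moments, variance growth and the Lyapunov condition. -/

lemma memLp_usesBin (hb : ∀ n, 1 ≤ b n) (n N : ℕ) (p : ENNReal) :
    MemLp (usesBin b zeroOne 0 n) p (unifLaw b zeroOne 0 N) := by
  have := isProbabilityMeasure_unifLaw hb N
  refine MemLp.of_bound (measurable_of_countable _).aestronglyMeasurable 1 (.of_forall fun x => ?_)
  rcases usesBin_eq_zero_or_one (b := b) n x with h | h <;> simp [h]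

lemma integrable_usesBin (hb : ∀ n, 1 ≤ b n) (n N : ℕ) :
    Integrable (usesBin b zeroOne 0 n) (unifLaw b zeroOne 0 N) :=
  memLp_one_iff_integrable.1 (memLp_usesBin hb n N 1)

lemma integral_usesBin (hb : ∀ n, 1 ≤ b n) {n N : ℕ} (hn : n < N) :
    ∫ x, usesBin b zeroOne 0 n x ∂(unifLaw b zeroOne 0 N) = b n / (b n + 1) := by
  rw [← real_usesBin_eq_one hb hn, ← integral_indicator_one (Set.to_countable _).measurableSet]
  congr 1 with x
  rcases usesBin_eq_zero_or_one (b := b) n x with h | h <;> simp [Set.indicator, h]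

lemma variance_usesBin (hb : ∀ n, 1 ≤ b n) {n N : ℕ} (hn : n < N) :
    Var[usesBin b zeroOne 0 n; unifLaw b zeroOne 0 N] = b n / (b n + 1) ^ 2 := by
  have := isProbabilityMeasure_unifLaw hb N
  have hsq : usesBin b zeroOne 0 n ^ 2 = usesBin b zeroOne 0 n := by
    funext x
    rcases usesBin_eq_zero_or_one (b := b) n x with h | h <;> simp [h]
  rw [variance_eq_sub (memLp_usesBin hb n N 2), hsq, integral_usesBin hb hn]
  field_simp
  ring

lemma abs_usesBin_sub_integral_le_one (hb : ∀ n, 1 ≤ b n) (n N x : ℕ) :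
    |usesBin b zeroOne 0 n x - ∫ y, usesBin b zeroOne 0 n y ∂(unifLaw b zeroOne 0 N)| ≤ 1 := by
  have := isProbabilityMeasure_unifLaw hb N
  have hY : ∀ x, 0 ≤ usesBin b zeroOne 0 n x ∧ usesBin b zeroOne 0 n x ≤ 1 := fun x => by
    rcases usesBin_eq_zero_or_one (b := b) n x with h | h <;> simp [h]
  have h0 : 0 ≤ ∫ y, usesBin b zeroOne 0 n y ∂(unifLaw b zeroOne 0 N) :=
    integral_nonneg fun x => (hY x).1
  have h1 : ∫ y, usesBin b zeroOne 0 n y ∂(unifLaw b zeroOne 0 N) ≤ 1 := by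
    calc _ ≤ ∫ _, (1 : ℝ) ∂(unifLaw b zeroOne 0 N) :=
          integral_mono (integrable_usesBin hb n N) (integrable_const _) fun x => (hY x).2
      _ = 1 := by simp
  rw [abs_le]
  constructor <;> linarith [(hY x).1, (hY x).2]

lemma tendsto_sum_variance_usesBin (hb : ∀ n, 1 ≤ b n)
    (hdiv : ¬ Summable (fun n : ℕ => 1 / (b n : ℝ))) :
    Tendsto (fun N => ∑ n ∈ Finset.range (N + 1),
      Var[usesBin b zeroOne 0 n; unifLaw b zeroOne 0 N]) atTop atTop := by
  have h := (not_summable_iff_tendsto_nat_atTop_of_nonneg fun n => by positivity).1 hdiv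
  -- The factor 1/4 comes from b + 1 ≤ 2b, which gives b/(b+1)² ≥ 1/(4b). The term n = N is dropped,
  -- using only that it is non-negative.
  refine tendsto_atTop_mono (fun N => ?_) (h.const_mul_atTop (by norm_num : (0 : ℝ) < 1 / 4))
  rw [Finset.sum_range_succ, Finset.mul_sum]
  refine le_add_of_le_of_nonneg (Finset.sum_le_sum fun n hn => ?_) (variance_nonneg _ _)
  rw [variance_usesBin hb (Finset.mem_range.1 hn)]
  have h1 : (1 : ℝ) ≤ b n := by exact_mod_cast hb n
  rw [div_mul_div_comm, div_le_div_iff₀ (by positivity) (by positivity)]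
  nlinarith

/-- The centered indicator is bounded by 1 in absolute value, so raising the exponent from 2 to 2 +
δ can only decrease its powers. -/
lemma integral_abs_rpow_le_variance (hb : ∀ n, 1 ≤ b n) (n N : ℕ) {δ : ℝ} (hδ : 0 < δ) :
    ∫ x, |usesBin b zeroOne 0 n x
        - ∫ y, usesBin b zeroOne 0 n y ∂(unifLaw b zeroOne 0 N)| ^ (2 + δ)
      ∂(unifLaw b zeroOne 0 N) ≤ Var[usesBin b zeroOne 0 n; unifLaw b zeroOne 0 N] := by
  have := isProbabilityMeasure_unifLaw hb N
  have hle := abs_usesBin_sub_integral_le_one hb n N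
  rw [variance_eq_integral (measurable_of_countable _).aemeasurable]
  refine integral_mono_of_nonneg (.of_forall fun x => by positivity) ?_ (.of_forall fun x => ?_)
  · refine Integrable.of_bound (measurable_of_countable _).aestronglyMeasurable 1
      (.of_forall fun x => ?_)
    rw [norm_pow]
    exact pow_le_one₀ (norm_nonneg _) (hle x)
  · change _ ≤ (_ : ℝ) ^ 2
    rw [← sq_abs, ← Real.rpow_two]
    exact Real.rpow_le_rpow_of_exponent_ge' (abs_nonneg _) (hle x) (by norm_num) (by linarith)

/-- The Lyapunov condition for the variables `Y_n`. -/
theorem tendsto_lyapunov_usesBin (hb : ∀ n, 1 ≤ b n)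
    (hdiv : ¬ Summable (fun n : ℕ => 1 / (b n : ℝ))) {δ : ℝ} (hδ : 0 < δ) :
    Tendsto (fun N : ℕ =>
        (∑ n ∈ Finset.range (N + 1),
          ∫ x, |usesBin b zeroOne 0 n x
              - ∫ y, usesBin b zeroOne 0 n y ∂(unifLaw b zeroOne 0 N)| ^ (2 + δ)
            ∂(unifLaw b zeroOne 0 N)) /
        √(∑ n ∈ Finset.range (N + 1),
          variance (usesBin b zeroOne 0 n) (unifLaw b zeroOne 0 N)) ^ (2 + δ))
      atTop (𝓝 0) := by
  have hV := tendsto_sum_variance_usesBin hb hdiv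
  -- With V the total variance, the ratio is at most V / √V^(2+δ) = √V^(−δ).
  have hlim := (tendsto_rpow_neg_atTop hδ).comp (Real.tendsto_sqrt_atTop.comp hV)
  refine squeeze_zero' (.of_forall fun N => ?_) ?_ hlim
  · exact div_nonneg (Finset.sum_nonneg fun n _ => integral_nonneg fun x => by positivity)
      (by positivity)
  · filter_upwards [hV.eventually_gt_atTop 0] with N hN
    have hs := Real.sqrt_pos.2 hN
    rw [div_le_iff₀ (by positivity), Function.comp_apply, Function.comp_apply, ← Real.rpow_add hs,
      neg_add_cancel_comm_assoc, Real.rpow_two, Real.sq_sqrt hN.le]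
    exact Finset.sum_le_sum fun n _ => integral_abs_rpow_le_variance hb n N hδ

/-- The sum stops at bin N, so the equality is claimed only almost everywhere: the law is carried by
integers that use no later bin. -/
lemma numSummands_ae_eq (hb : ∀ n, 1 ≤ b n) (N : ℕ) :
    (fun x => (numSummands b zeroOne 0 x : ℝ)) =ᵐ[unifLaw b zeroOne 0 N]
      ∑ n : Fin (N + 1), usesBin b zeroOne 0 n := by
  filter_upwards [ae_mem_largestInBin hb N] with x hx
  rw [numSummands_eq_of_mem hb hx, Finset.sum_apply,
    Fin.sum_univ_eq_sum_range (fun n => usesBin b zeroOne 0 n x)]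

lemma integral_numSummands (hb : ∀ n, 1 ≤ b n) (N : ℕ) :
    ∫ x, (numSummands b zeroOne 0 x : ℝ) ∂(unifLaw b zeroOne 0 N)
      = ∑ n : Fin (N + 1), ∫ x, usesBin b zeroOne 0 n x ∂(unifLaw b zeroOne 0 N) := by
  rw [integral_congr_ae (numSummands_ae_eq hb N)]
  simp only [Finset.sum_apply]
  exact integral_finsetSum _ fun n _ => integrable_usesBin hb n N

lemma variance_numSummands (hb : ∀ n, 1 ≤ b n) (N : ℕ) :
    Var[fun x => (numSummands b zeroOne 0 x : ℝ); unifLaw b zeroOne 0 N]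
      = ∑ n : Fin (N + 1), Var[usesBin b zeroOne 0 n; unifLaw b zeroOne 0 N] := by
  rw [variance_congr (numSummands_ae_eq hb N)]
  exact IndepFun.variance_sum (fun n _ => memLp_usesBin hb n N 2)
    fun m _ n _ hmn => (iIndepFun_usesBin hb N).indepFun hmn

end Law

end BinDecomp

theorem theorem1p2 (b : ℕ → ℕ) (hb : ∀ n, 1 ≤ b n)
    (hdiv : ¬ Summable (fun n : ℕ => 1 / (b n : ℝ))) :
    -- every positive integer has exactly one legal decomposition
    (∀ x : ℕ, 0 < x → ∃! D : Finset ℕ,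
      BinDecomp.IsDecomposition b BinDecomp.zeroOne 0 D x) ∧
    -- if the largest summand of `x` lies in bin `N`, the number of summands is the sum of the `Y_n`
    (∀ N, ∀ x ∈ BinDecomp.largestInBin b BinDecomp.zeroOne 0 N,
      (BinDecomp.numSummands b BinDecomp.zeroOne 0 x : ℝ) =
        ∑ n ∈ Finset.range (N + 1), BinDecomp.usesBin b BinDecomp.zeroOne 0 n x) ∧
    -- for such random `x` the `Y_n` are independent Bernoulli variables, with `Y_N = 1`
    (∀ N,
      iIndepFun (fun n : Fin (N + 1) => BinDecomp.usesBin b BinDecomp.zeroOne 0 n)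
        (BinDecomp.unifLaw b BinDecomp.zeroOne 0 N) ∧
      (∀ n < N,
        (BinDecomp.unifLaw b BinDecomp.zeroOne 0 N).real
            {x | BinDecomp.usesBin b BinDecomp.zeroOne 0 n x = 1} = b n / (b n + 1) ∧
        (BinDecomp.unifLaw b BinDecomp.zeroOne 0 N).real
            {x | BinDecomp.usesBin b BinDecomp.zeroOne 0 n x = 0} = 1 / (b n + 1)) ∧
      ∀ x ∈ BinDecomp.largestInBin b BinDecomp.zeroOne 0 N,
        BinDecomp.usesBin b BinDecomp.zeroOne 0 N x = 1) ∧
    -- the Lyapunov condition holds for every exponent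
    (∀ δ : ℝ, 0 < δ → Tendsto (fun N : ℕ =>
        (∑ n ∈ Finset.range (N + 1),
          ∫ x, |BinDecomp.usesBin b BinDecomp.zeroOne 0 n x
              - ∫ y, BinDecomp.usesBin b BinDecomp.zeroOne 0 n y
                  ∂(BinDecomp.unifLaw b BinDecomp.zeroOne 0 N)| ^ (2 + δ)
            ∂(BinDecomp.unifLaw b BinDecomp.zeroOne 0 N)) /
        √(∑ n ∈ Finset.range (N + 1),
          variance (BinDecomp.usesBin b BinDecomp.zeroOne 0 n)
            (BinDecomp.unifLaw b BinDecomp.zeroOne 0 N)) ^ (2 + δ))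
      atTop (𝓝 0)) ∧
    -- the standardized number of summands converges in distribution to the standard normal
    (∃ _ : ∀ N, IsProbabilityMeasure (BinDecomp.unifLaw b BinDecomp.zeroOne 0 N),
      TendstoInDistribution
        (fun (N : ℕ) (x : ℕ) =>
          ((BinDecomp.numSummands b BinDecomp.zeroOne 0 x : ℝ)
            - ∫ y, (BinDecomp.numSummands b BinDecomp.zeroOne 0 y : ℝ)
                ∂(BinDecomp.unifLaw b BinDecomp.zeroOne 0 N)) /
          √(variance (fun y : ℕ => (BinDecomp.numSummands b BinDecomp.zeroOne 0 y : ℝ))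
              (BinDecomp.unifLaw b BinDecomp.zeroOne 0 N)))
        atTop (id : ℝ → ℝ)
        (fun N => BinDecomp.unifLaw b BinDecomp.zeroOne 0 N) (gaussianReal 0 1)) := by
  have hprob := BinDecomp.isProbabilityMeasure_unifLaw hb
  refine ⟨fun x _ => ?_, fun N x hx => BinDecomp.numSummands_eq_of_mem hb hx, fun N => ⟨?_, ?_, ?_⟩,
    fun δ hδ => BinDecomp.tendsto_lyapunov_usesBin hb hdiv hδ, hprob, ?_⟩
  · obtain ⟨D, hD⟩ := BinDecomp.exists_isDecomposition hb x
    exact ⟨D, hD, fun E hE => hE.unique hb hD⟩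
  · exact BinDecomp.iIndepFun_usesBin hb N
  · exact fun n hn => ⟨BinDecomp.real_usesBin_eq_one hb hn, BinDecomp.real_usesBin_eq_zero hb hn⟩
  · exact fun x hx => BinDecomp.usesBin_largest hx
  · have hclt := tendstoInDistribution_sum_of_bounded (C := 1)
      (P := fun N => BinDecomp.unifLaw b BinDecomp.zeroOne 0 N)
      (X := fun N (n : Fin (N + 1)) => BinDecomp.usesBin b BinDecomp.zeroOne 0 n)
      (fun N n => (measurable_of_countable _).aemeasurable)
      (BinDecomp.iIndepFun_usesBin hb)
      (fun N n => .of_forall (BinDecomp.abs_usesBin_sub_integral_le_one hb n N))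
      (by
        refine (BinDecomp.tendsto_sum_variance_usesBin hb hdiv).congr fun N => ?_
        exact (Fin.sum_univ_eq_sum_range (fun n => variance
          (BinDecomp.usesBin b BinDecomp.zeroOne 0 n)
          (BinDecomp.unifLaw b BinDecomp.zeroOne 0 N)) (N + 1)).symm)
    -- The theorem was applied to the sum of the indicators; the number of summands agrees with it
    -- almost surely and has the same mean and variance.
    refine hclt.congr (fun N => ?_) .rfl
    filter_upwards [BinDecomp.numSummands_ae_eq hb N] with x hx
    rw [hx, BinDecomp.integral_numSummands hb, BinDecomp.variance_numSummands hb, Finset.sum_apply]
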